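/- Graphs may have loops and multiple edges, and every edge has length $1$. Covering maps are surjective, send vertices to vertices, and restrict to a bijection from the set of oriented edges issuing from each vertex to the set of those issuing from its image. A covering map from a connected graph is regular if its group of deck transformations acts transitively on every fibre. A quasitree is a connected graph that is quasi-isometric to a tree. For a locally finite graph $X$, the group $\mathrm{Aut}(X)$ carries the compact-open topology, and a uniform lattice in $\mathrm{Aut}(X)$ is a discrete subgroup that acts properly and cocompactly on $X$. **Theorem.** There exist a locally finite quasitree $X$, finite graphs $X_1$ and $X_2$, a covering map $X\to X_1$, and a regular covering map $X\to X_2$, such that $\mathrm{Aut}(X)$ contains a uniform lattice and such that there is no finite graph $\hat X$ for which there are covering maps $X\to\hat X$, $\hat X\to X_1$ and $\hat X\to X_2$. (The covering maps through $\hat X$ are arbitrary: their compositions are not required to be the given maps $X\to X_1$ and $X\to X_2$.) -/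

import Mathlib

/-- A graph in the sense of Serre (loops and multiple edges are allowed).  `D` is the set `E^±` of
oriented edges, `src` is the initial vertex of an oriented edge, and `inv` reverses the orientation;
a geometric edge is a pair `{d, inv d}`.  -/
structure SerreGraph where
  /-- vertices -/
  V : Type
  /-- oriented edges -/
  D : Type
  /-- initial vertex -/
  src : D → V
  /-- the same edge with the opposite orientation -/
  inv : D → D
  inv_inv : ∀ d, inv (inv d) = d
  inv_ne : ∀ d, inv d ≠ d

namespace SerreGraph

/-- The terminal vertex of an oriented edge. -/
def tgt (X : SerreGraph) (d : X.D) : X.V := X.src (X.inv d)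

/-- The set of oriented edges with initial vertex `v`. -/
def star (X : SerreGraph) (v : X.V) : Set X.D := {d | X.src d = v}

/-- A graph is finite if it has finitely many vertices and edges. -/
def IsFinite (X : SerreGraph) : Prop := Finite X.V ∧ Finite X.D

/-- A graph is locally finite if each vertex has finite valence. -/
def IsLocallyFinite (X : SerreGraph) : Prop := ∀ v, (X.star v).Finite

/-- The adjacency relation of distinct vertices, as a simple graph (forgetting loops and
multiplicities of edges).  It has the same connected components and the same path metric on vertices
as `X`. -/
def toSimpleGraph (X : SerreGraph) : SimpleGraph X.V :=
  SimpleGraph.fromRel fun v w => ∃ d, X.src d = v ∧ X.tgt d = w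

/-- Connected (and non-empty) graphs. -/
def IsConnected (X : SerreGraph) : Prop := X.toSimpleGraph.Connected

/-- The path metric on the vertices (meaningful when `X` is connected). -/
noncomputable def dist (X : SerreGraph) (v w : X.V) : ℕ := X.toSimpleGraph.dist v w

/-- A quasitree: a connected graph which is quasi-isometric to a tree (as all edges have length one,
quasi-isometries may be taken between the vertex sets with their path metrics). -/
def IsQuasitree (X : SerreGraph) : Prop :=
  X.IsConnected ∧
    ∃ (W : Type) (T : SimpleGraph W), T.IsTree ∧
      ∃ (f : X.V → W) (K C : ℝ), 1 ≤ K ∧ 0 ≤ C ∧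
        (∀ v w, K⁻¹ * (X.dist v w : ℝ) - C ≤ (T.dist (f v) (f w) : ℝ) ∧
          (T.dist (f v) (f w) : ℝ) ≤ K * (X.dist v w : ℝ) + C) ∧
        ∀ t, ∃ v, (T.dist (f v) t : ℝ) ≤ C

/-- Graph morphisms: vertices go to vertices and edges to edges. -/
structure Hom (X Y : SerreGraph) where
  onV : X.V → Y.V
  onD : X.D → Y.D
  src_onD : ∀ d, Y.src (onD d) = onV (X.src d)
  inv_onD : ∀ d, Y.inv (onD d) = onD (X.inv d)

/-- A covering map: a surjective morphism that is a bijection from the star of each vertex onto the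
star of its image. -/
def Hom.IsCovering {X Y : SerreGraph} (p : Hom X Y) : Prop :=
  Function.Surjective p.onV ∧ ∀ v, Set.BijOn p.onD (X.star v) (Y.star (p.onV v))

/-- `X` covers `Y`. -/
def Covers (X Y : SerreGraph) : Prop := ∃ p : Hom X Y, p.IsCovering

/-- The automorphism group of `X`, as a group of pairs of a permutation of the vertices and a
permutation of the oriented edges. -/
def Aut (X : SerreGraph) : Subgroup (Equiv.Perm X.V × Equiv.Perm X.D) where
  carrier := {g | (∀ d, X.src (g.2 d) = g.1 (X.src d)) ∧ ∀ d, X.inv (g.2 d) = g.2 (X.inv d)}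
  one_mem' := by simp
  mul_mem' := by
    rintro a b ⟨ha, ha'⟩ ⟨hb, hb'⟩
    simp [ha, ha', hb, hb']
  inv_mem' := by
    rintro a ⟨ha, ha'⟩
    refine ⟨fun d => ?_, fun d => ?_⟩
    · have h := ha (a.2.symm d)
      rw [Equiv.apply_symm_apply] at h
      change X.src (a.2.symm d) = a.1.symm (X.src d)
      rw [h, Equiv.symm_apply_apply]
    · have h := ha' (a.2.symm d)
      rw [Equiv.apply_symm_apply] at h
      change X.inv (a.2.symm d) = a.2.symm (X.inv d)
      rw [h, Equiv.symm_apply_apply]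

/-- The compact-open topology on the automorphism group: the topology of pointwise convergence on
the discrete sets of vertices and oriented edges. -/
abbrev autTopology (X : SerreGraph) : TopologicalSpace X.Aut :=
  letI : TopologicalSpace X.V := ⊥
  letI : TopologicalSpace X.D := ⊥
  TopologicalSpace.induced
    (fun g => ((g.1.1 : X.V → X.V), (g.1.2 : X.D → X.D))) inferInstance

/-- A uniform lattice in `Aut X`: a discrete subgroup that acts properly and cocompactly on the
(locally finite) graph `X`.  A compact subset of the locally finite graph `X` lies in a finite
subgraph, so properness is finiteness of the set of elements that do not move a given finite set of
vertices off itself, and cocompactness is the existence of finitely many vertices and edges whose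
translates exhaust `X`. -/
def IsUniformLattice (X : SerreGraph) (Γ : Subgroup X.Aut) : Prop :=
  (letI := X.autTopology; DiscreteTopology Γ) ∧
  (∀ S : Set X.V, S.Finite → {g : X.Aut | g ∈ Γ ∧ (g.1.1 '' S ∩ S).Nonempty}.Finite) ∧
  (∃ S : Set X.V, S.Finite ∧ ∀ v, ∃ g ∈ Γ, ∃ s ∈ S, g.1.1 s = v) ∧
  ∃ E : Set X.D, E.Finite ∧ ∀ d, ∃ g ∈ Γ, ∃ e ∈ E, g.1.2 e = d

/-- A deck transformation (element of the Galois group) of a morphism. -/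
def Hom.IsDeck {X Y : SerreGraph} (p : Hom X Y) (g : X.Aut) : Prop :=
  (∀ v, p.onV (g.1.1 v) = p.onV v) ∧ ∀ d, p.onD (g.1.2 d) = p.onD d

/-- A regular covering (of a connected graph): the group of deck transformations acts transitively
on each fibre. -/
def Hom.IsRegularCovering {X Y : SerreGraph} (p : Hom X Y) : Prop :=
  p.IsCovering ∧ ∀ v w, p.onV v = p.onV w → ∃ g : X.Aut, p.IsDeck g ∧ g.1.1 v = w

end SerreGraph

/-! The graph `triTree` is the Cayley graph of C₃ * C₂ * C₂ * C₂, so each vertex lies on one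
triangle and three further edges. It is a quasitree: reduced words span a tree on the same vertex
set with comparable distances. A homomorphism to Z/6 gives the regular covering of `prism`, and
right multiplication gives the lattice.

The obstruction is a count. In a finite common cover Y, call a vertex outer if it lies over an outer
vertex of `twinGraph`. Lifting one triangle direction of `prism` gives a permutation ρ of the
vertices of Y such that y, ρ y, ρ² y are the vertices of the image of a triangle of `triTree`.
Closed walks of length three in `twinGraph` meet at most one outer vertex (`twinGraph_triangle`), so
at most a third of the vertices of Y are outer. Lifting an edge of `twinGraph` between inner and
outer vertices shows that at least half are outer (`no_common_finite_cover`).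

The infinite graph `triTree` still covers `twinGraph`: the group acts on states arranged in
triangles with one outer and two inner vertices, and the surplus of inner vertices is absorbed by a
bijection ℕ ≃ Bool × Bool × ℕ (`TwinState.split`). -/

open Monoid

/-! ### Trees from parent maps -/

/-- The graph spanned by a parent map whose iterates lead to a root is a tree. -/
theorem SimpleGraph.isTree_fromRel_of_parent {V : Type*} (π : V → V) (depth : V → ℕ) (o : V)
    (ho : π o = o) (hπ : ∀ v, v ≠ o → depth (π v) < depth v) :
    (SimpleGraph.fromRel fun v w => π w = v).IsTree := by
  set T := SimpleGraph.fromRel fun v w => π w = v with hT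
  have adj_parent : ∀ v, v ≠ o → T.Adj v (π v) := by
    intro v hv
    refine (SimpleGraph.fromRel_adj _ _ _).2 ⟨fun h => ?_, Or.inr rfl⟩
    have := hπ v hv
    rw [← h] at this
    exact lt_irrefl _ this
  have reach : ∀ n v, depth v ≤ n → T.Reachable v o := by
    intro n
    induction n with
    | zero =>
      intro v hv
      by_cases h : v = o
      · rw [h]
      · have := hπ v h
        omega
    | succ n ih =>
      intro v hv
      by_cases h : v = o
      · rw [h]
      · have := hπ v h
        exact (adj_parent v h).reachable.trans (ih _ (by omega))
  have eq_parent : ∀ v w, T.Adj v w → depth w ≤ depth v → w = π v := by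
    intro v w h hd
    obtain ⟨hne, h | h⟩ := (SimpleGraph.fromRel_adj _ _ _).1 h
    · have hw : w ≠ o := by
        rintro rfl
        exact hne (h.symm.trans ho)
      have := hπ w hw
      rw [h] at this
      omega
    · exact h.symm
  have : Nonempty V := ⟨o⟩
  refine ⟨⟨fun v w => (reach _ v le_rfl).trans (reach _ w le_rfl).symm⟩, ?_⟩
  classical
  intro u c hc
  -- At a vertex of maximal depth on a cycle, both neighbours would be its parent.
  obtain ⟨v, hv, hmax⟩ := Finset.exists_max_image c.support.toFinset depth
    ⟨u, by simp⟩
  rw [List.mem_toFinset] at hv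
  have hc' := hc.rotate hv
  have hle : ∀ w ∈ (c.rotate v hv).support, depth w ≤ depth v := by
    intro w hw
    exact hmax w (by rw [List.mem_toFinset]; exact (c.mem_support_rotate_iff v hv).1 hw)
  refine hc'.snd_ne_penultimate ?_
  rw [eq_parent v _ (SimpleGraph.Walk.adj_snd hc'.not_nil)
      (hle _ (SimpleGraph.Walk.getVert_mem_support _ _)),
    eq_parent v _ (SimpleGraph.Walk.adj_penultimate hc'.not_nil).symm
      (hle _ (SimpleGraph.Walk.getVert_mem_support _ _))]

/-! ### Parents and depth in free products -/

namespace Monoid.CoprodI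

variable {ι : Type*} {M : ι → Type*} [∀ i, Monoid (M i)]

/-- The reduced word with its first letter removed. -/
def Word.dropHead (w : Word M) : Word M where
  toList := w.toList.tail
  ne_one := fun l hl => w.ne_one l (List.mem_of_mem_tail hl)
  chain_ne := w.chain_ne.tail

theorem Word.dropHead_cons {i} (m : M i) (w : Word M) (h1 h2) :
    (Word.cons m w h1 h2).dropHead = w := rfl

variable [DecidableEq ι] [∀ i, DecidableEq (M i)]

theorem Word.equiv_prod (w : Word M) : Word.equiv w.prod = w := Word.equiv.right_inv w

/-- The element of the free product whose reduced word is obtained by removing the first letter. -/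
def parent (g : CoprodI M) : CoprodI M := Word.equiv.symm (Word.equiv g).dropHead

/-- The number of letters of the reduced word. -/
def depth (g : CoprodI M) : ℕ := (Word.equiv g).toList.length

theorem parent_one : parent (1 : CoprodI M) = 1 := by
  have h : (Word.equiv (1 : CoprodI M)) = Word.empty := by
    rw [← Word.prod_empty (M := M)]
    exact Word.equiv_prod _
  rw [parent, h]
  exact Word.prod_empty

theorem depth_parent_lt {g : CoprodI M} (hg : g ≠ 1) : depth (parent g) < depth g := by
  rw [depth, depth, parent, Equiv.apply_symm_apply]
  change (Word.equiv g).toList.tail.length < _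
  rw [List.length_tail]
  suffices 0 < (Word.equiv g).toList.length by omega
  rw [List.length_pos_iff]
  intro h
  apply hg
  have h' : Word.equiv g = Word.empty := Word.ext h
  rw [← Word.equiv.symm_apply_apply g, h']
  exact Word.prod_empty

theorem parent_of_mul_prod {i} (m : M i) (w : Word M) (hw : w.fstIdx ≠ some i) (hm : m ≠ 1) :
    parent (of m * w.prod) = w.prod := by
  have : Word.equiv (of m * w.prod) = Word.cons m w hw hm := by
    rw [← Word.prod_cons i m w hm hw]
    exact Word.equiv_prod _
  rw [parent, this, Word.dropHead_cons]
  rfl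

/-- Elements differing by left multiplication by a letter are parent and child, or siblings. -/
theorem parent_of_mul {i} (m : M i) (g : CoprodI M) :
    parent (of m * g) = g ∨ parent g = of m * g ∨ parent (of m * g) = parent g := by
  -- Split off the possibly trivial first letter in factor `i`; multiplication by `m` changes only
  -- that letter.
  obtain ⟨p, hp⟩ : ∃ p : Word.Pair M i, g = of p.head * p.tail.prod := by
    refine ⟨Word.equivPair i (Word.equiv g), ?_⟩
    rw [← Word.prod_rcons, ← Word.equivPair_symm, Equiv.symm_apply_apply]
    exact (Word.equiv.symm_apply_apply g).symm
  rw [hp, ← mul_assoc, ← map_mul]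
  by_cases h1 : p.head = 1
  · by_cases h2 : m * p.head = 1
    · right; right; rw [h2, h1]
    · left
      rw [parent_of_mul_prod _ _ p.fstIdx_ne h2, h1, map_one, one_mul]
  · right
    rw [parent_of_mul_prod _ _ p.fstIdx_ne h1]
    by_cases h2 : m * p.head = 1
    · left; rw [h2, map_one, one_mul]
    · right; rw [parent_of_mul_prod _ _ p.fstIdx_ne h2]

end Monoid.CoprodI

/-! ### Cayley graphs, their lattices and quotients -/

namespace SerreGraph

/-- The Cayley graph with an edge labelled `l` from `g` to `s l * g`, where `ν` describes inversion
of labels. -/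
abbrev cayley {G L : Type} [Group G] (s : L → G) (ν : L → L) (hν : ∀ l, ν (ν l) = l)
    (hs : ∀ l, s (ν l) = (s l)⁻¹) (h1 : ∀ l, s l ≠ 1) : SerreGraph where
  V := G
  D := G × L
  src d := d.1
  inv d := (s d.2 * d.1, ν d.2)
  inv_inv := by
    rintro ⟨g, l⟩
    simp [hν, hs]
  inv_ne := by
    rintro ⟨g, l⟩ h
    exact h1 l (mul_eq_right.1 (congrArg Prod.fst h))

section cayley

variable {G L : Type} [Group G] (s : L → G) (ν : L → L) (hν : ∀ l, ν (ν l) = l)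
    (hs : ∀ l, s (ν l) = (s l)⁻¹) (h1 : ∀ l, s l ≠ 1)

theorem cayley_isLocallyFinite [Finite L] : (cayley s ν hν hs h1).IsLocallyFinite := by
  intro v
  refine (Set.finite_range fun l : L => ((v, l) : G × L)).subset ?_
  rintro ⟨g, l⟩ (rfl : g = v)
  exact ⟨l, rfl⟩

/-- Right multiplication as an automorphism of the Cayley graph. -/
def cayleyAut (h : G) : (cayley s ν hν hs h1).Aut :=
  ⟨(⟨fun v => v * h, fun v => v * h⁻¹, fun v => mul_inv_cancel_right v h,
      fun v => inv_mul_cancel_right v h⟩,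
    ⟨fun d => (d.1 * h, d.2), fun d => (d.1 * h⁻¹, d.2),
      fun d => Prod.ext (mul_inv_cancel_right d.1 h) rfl,
      fun d => Prod.ext (inv_mul_cancel_right d.1 h) rfl⟩),
    fun _ => rfl, fun d => Prod.ext (mul_assoc (s d.2) d.1 h).symm rfl⟩

/-- The group acting on its Cayley graph. -/
def cayleyLattice : Subgroup (cayley s ν hν hs h1).Aut where
  carrier := Set.range (cayleyAut s ν hν hs h1)
  one_mem' := ⟨1, by
    apply Subtype.ext
    exact Prod.ext (Equiv.ext fun v => mul_one (M := G) v)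
      (Equiv.ext fun d => Prod.ext (mul_one d.1) rfl)⟩
  mul_mem' := by
    rintro _ _ ⟨a, rfl⟩ ⟨b, rfl⟩
    refine ⟨b * a, Subtype.ext ?_⟩
    exact Prod.ext (Equiv.ext fun v => (mul_assoc (G := G) v b a).symm)
      (Equiv.ext fun d => Prod.ext (mul_assoc d.1 b a).symm rfl)
  inv_mem' := by
    rintro _ ⟨a, rfl⟩
    refine ⟨a⁻¹, Subtype.ext ?_⟩
    exact Prod.ext (Equiv.ext fun v => rfl) (Equiv.ext fun d => rfl)

theorem cayleyLattice_isUniformLattice [Finite L] :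
    (cayley s ν hν hs h1).IsUniformLattice (cayleyLattice s ν hν hs h1) := by
  refine ⟨?_, ?_, ⟨{(1 : G)}, Set.finite_singleton _, fun v => ?_⟩,
    ⟨Set.range fun l => ((1 : G), l), Set.finite_range _, ?_⟩⟩
  · let t₁ : TopologicalSpace G := ⊥
    let t₂ : TopologicalSpace (G × L) := ⊥
    let τ := (cayley s ν hν hs h1).autTopology
    have : DiscreteTopology G := ⟨rfl⟩
    refine discreteTopology_iff_isOpen_singleton.2 ?_
    rintro ⟨_, a, rfl⟩
    have hind : Continuous fun g : (cayley s ν hν hs h1).Aut =>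
        ((g.1.1 : G → G), (g.1.2 : G × L → G × L)) := continuous_induced_dom
    -- An element of the lattice is determined by its value at `1`, so singletons are preimages
    -- under one evaluation.
    have hcont : Continuous fun g : cayleyLattice s ν hν hs h1 => (g.1.1.1 : G → G) 1 :=
      (continuous_apply (1 : G)).comp (continuous_fst.comp (hind.comp continuous_subtype_val))
    convert (isOpen_discrete ({a} : Set G)).preimage hcont using 1
    ext ⟨_, b, rfl⟩
    constructor
    · intro h
      rw [Set.mem_singleton_iff.1 h]
      exact (one_mul a : (1 : G) * a = a)
    · intro h
      have : b = a := (one_mul b).symm.trans (h : (1 : G) * b = a)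
      subst this
      rfl
  · intro S hS
    refine ((hS.prod hS).image fun q : G × G => cayleyAut s ν hν hs h1 (q.1⁻¹ * q.2)).subset ?_
    rintro _ ⟨⟨a, rfl⟩, w, ⟨v, hv, rfl⟩, hw⟩
    refine ⟨(v, v * a), ⟨hv, hw⟩, ?_⟩
    exact congrArg _ (inv_mul_cancel_left v a)
  · exact ⟨_, ⟨v, rfl⟩, (1 : G), rfl, one_mul (M := G) v⟩
  · rintro ⟨v, l⟩
    exact ⟨_, ⟨v, rfl⟩, (1, l), ⟨l, rfl⟩, Prod.ext (one_mul v) rfl⟩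

/-- A group homomorphism that matches generators induces a morphism of Cayley graphs. -/
def cayleyMap {N : Type} [Group N] (φ : G →* N) {s' : L → N} (hφ : ∀ l, φ (s l) = s' l)
    (hs' : ∀ l, s' (ν l) = (s' l)⁻¹) (h1' : ∀ l, s' l ≠ 1) :
    Hom (cayley s ν hν hs h1) (cayley s' ν hν hs' h1') where
  onV := φ
  onD d := (φ d.1, d.2)
  src_onD _ := rfl
  inv_onD d := by
    refine Prod.ext ?_ rfl
    change s' d.2 * φ d.1 = φ (s d.2 * d.1)
    rw [map_mul, hφ]

theorem cayleyMap_isRegularCovering {N : Type} [Group N] (φ : G →* N) {s' : L → N}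
    (hφ : ∀ l, φ (s l) = s' l) (hs' : ∀ l, s' (ν l) = (s' l)⁻¹) (h1' : ∀ l, s' l ≠ 1)
    (hsurj : Function.Surjective φ) :
    (cayleyMap s ν hν hs h1 φ hφ hs' h1').IsRegularCovering := by
  refine ⟨⟨hsurj, fun v => ⟨?_, ?_, ?_⟩⟩,
    fun v w h => ⟨cayleyAut s ν hν hs h1 ((v : G)⁻¹ * (w : G)), ?_, ?_⟩⟩
  · rintro ⟨g, l⟩ (rfl : g = v)
    rfl
  · rintro ⟨g, l⟩ (rfl : g = v) ⟨g', l'⟩ (rfl : g' = g) h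
    exact Prod.ext rfl (Prod.ext_iff.1 h).2
  · rintro ⟨n, l⟩ (rfl : n = φ v)
    exact ⟨(v, l), rfl, rfl⟩
  · have hk : φ ((v : G)⁻¹ * (w : G)) = 1 := by
      rw [map_mul, map_inv, inv_mul_eq_one]
      exact h
    have key : ∀ u : G, φ (u * ((v : G)⁻¹ * (w : G))) = φ u := fun u => by
      rw [map_mul, hk, mul_one]
    exact ⟨key, fun d => Prod.ext (key d.1) rfl⟩
  · exact mul_inv_cancel_left v w

end cayley

/-! ### Cayley graphs of free products are quasitrees -/

section freeProduct

variable {ι : Type} {M : ι → Type} [∀ i, Group (M i)] [DecidableEq ι] [∀ i, DecidableEq (M i)]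
  {L : Type} (s : L → CoprodI M) (ν : L → L) (hν : ∀ l, ν (ν l) = l)
  (hs : ∀ l, s (ν l) = (s l)⁻¹) (h1 : ∀ l, s l ≠ 1)

/-- The Cayley graph of a free product, with generators taken from the factors and including every
nontrivial element of each factor, is a quasitree. -/
theorem cayley_isQuasitree (hof : ∀ l, ∃ (i : ι) (m : M i), s l = CoprodI.of m)
    (hgen : ∀ (i : ι) (m : M i), m ≠ 1 → ∃ l, s l = CoprodI.of m) :
    (cayley s ν hν hs h1).IsQuasitree := by
  set X := cayley s ν hν hs h1
  have hT := SimpleGraph.isTree_fromRel_of_parent (V := CoprodI M) CoprodI.parent CoprodI.depth 1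
    CoprodI.parent_one fun _ => CoprodI.depth_parent_lt
  set T : SimpleGraph (CoprodI M) := SimpleGraph.fromRel fun v w => CoprodI.parent w = v
  have hle : T ≤ X.toSimpleGraph := by
    have key : ∀ g : CoprodI M, g ≠ 1 → ∃ l, s l * CoprodI.parent g = g := by
      intro g hg
      have hw : g = (CoprodI.Word.equiv g).prod := (CoprodI.Word.equiv.symm_apply_apply g).symm
      generalize CoprodI.Word.equiv g = w at hw
      induction w using CoprodI.Word.consRecOn with
      | empty => exact absurd hw hg
      | cons i m w h2 h3 _ =>
        obtain ⟨l, hl⟩ := hgen i m h3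
        refine ⟨l, ?_⟩
        rw [hw, CoprodI.Word.prod_cons, CoprodI.parent_of_mul_prod _ _ h2 h3, hl]
    have key2 : ∀ v w : CoprodI M, v ≠ w → CoprodI.parent w = v →
        ∃ d, X.src d = v ∧ X.tgt d = w := by
      rintro v w hne rfl
      obtain ⟨l, hl⟩ := key w (by
        rintro rfl
        exact hne CoprodI.parent_one)
      exact ⟨(CoprodI.parent w, l), rfl, hl⟩
    intro v w hvw
    obtain ⟨hne, h | h⟩ := (SimpleGraph.fromRel_adj _ _ _).1 hvw
    · exact (SimpleGraph.fromRel_adj _ _ _).2 ⟨hne, Or.inl (key2 v w hne h)⟩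
    · exact (SimpleGraph.fromRel_adj _ _ _).2 ⟨hne, Or.inr (key2 w v hne.symm h)⟩
  have hconn : X.toSimpleGraph.Connected := hT.1.mono hle
  have hup : ∀ g : CoprodI M, T.dist g (CoprodI.parent g) ≤ 1 := by
    intro g
    by_cases h : g = CoprodI.parent g
    · rw [← h, SimpleGraph.dist_self]
      exact zero_le_one
    · exact (SimpleGraph.dist_eq_one_iff_adj.2
        ((SimpleGraph.fromRel_adj _ _ _).2 ⟨h, Or.inr rfl⟩)).le
  have hedge : ∀ v w : CoprodI M, X.toSimpleGraph.Adj v w → T.dist v w ≤ 2 := by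
    have key : ∀ v w : CoprodI M, (∃ d, X.src d = v ∧ X.tgt d = w) → T.dist v w ≤ 2 := by
      rintro _ _ ⟨⟨v, l⟩, rfl, rfl⟩
      change T.dist v (s l * v) ≤ 2
      obtain ⟨i, m, hm⟩ := hof l
      rw [hm]
      have h1 := hup v
      have h2 := hup (CoprodI.of m * v)
      rw [SimpleGraph.dist_comm] at h2
      rcases CoprodI.parent_of_mul m v with h | h | h
      · rw [h] at h2; omega
      · rw [h] at h1; omega
      · rw [h] at h2
        have := hT.1.dist_triangle (u := v) (v := CoprodI.parent v) (w := CoprodI.of m * v)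
        omega
    intro v w hvw
    obtain ⟨hne, h | h⟩ := (SimpleGraph.fromRel_adj _ _ _).1 hvw
    · exact key v w h
    · rw [SimpleGraph.dist_comm]
      exact key w v h
  have hlow : ∀ v w, X.dist v w ≤ T.dist v w := by
    intro v w
    obtain ⟨p, hp⟩ := hT.1.exists_walk_length_eq_dist v w
    rw [← hp, ← SimpleGraph.Walk.length_mapLe hle p]
    exact SimpleGraph.dist_le _
  have hhigh : ∀ v w, T.dist v w ≤ 2 * X.dist v w := by
    intro v w
    obtain ⟨p, hp⟩ := hconn.exists_walk_length_eq_dist v w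
    change _ ≤ 2 * X.toSimpleGraph.dist v w
    rw [← hp]
    clear hp
    induction p with
    | nil => simp
    | @cons u v w h p ih =>
      have h3 := hT.1.dist_triangle (u := u) (v := v) (w := w)
      have h4 := hedge _ _ h
      change _ ≤ 2 * (p.length + 1)
      omega
  -- The identity works with K = 2: `T` is a subgraph of the Cayley graph, whose edges join vertices
  -- at `T`-distance at most 2 (siblings).
  refine ⟨hconn, CoprodI M, T, hT, id, 2, 0, one_le_two, le_rfl, fun v w => ⟨?_, ?_⟩, fun t => ⟨t, ?_⟩⟩
  · have h : (X.dist v w : ℝ) ≤ T.dist v w := by exact_mod_cast hlow v w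
    have h0 : (0 : ℝ) ≤ X.dist v w := Nat.cast_nonneg _
    simp only [id]
    linarith
  · have h : (T.dist v w : ℝ) ≤ 2 * X.dist v w := by exact_mod_cast hhigh v w
    simpa using h
  · simp [SimpleGraph.dist_self]

end freeProduct

end SerreGraph

/-! ### Lifting steps through a covering -/

namespace SerreGraph

theorem Hom.tgt_onD {X Y : SerreGraph} (p : Hom X Y) (d : X.D) :
    Y.tgt (p.onD d) = p.onV (X.tgt d) := by
  rw [tgt, p.inv_onD, p.src_onD, tgt]

/-- A covering lifts every injective choice of a way to step from each vertex to a neighbour. -/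
theorem Hom.IsCovering.exists_injective_step {Y Z : SerreGraph} {q : Hom Y Z} (hq : q.IsCovering)
    (δ : Z.V → Z.D) (hδ : ∀ v, Z.src (δ v) = v) (hinj : Function.Injective fun v => Z.tgt (δ v)) :
    ∃ ρ : Y.V → Y.V, Function.Injective ρ ∧
      ∀ y, ∃ e, Y.src e = y ∧ Y.tgt e = ρ y ∧ q.onD e = δ (q.onV y) := by
  choose e he hqe using fun y => (hq.2 y).surjOn (hδ (q.onV y))
  refine ⟨fun y => Y.tgt (e y), fun y y' h => ?_, fun y => ⟨e y, he y, rfl, hqe y⟩⟩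
  have hv : q.onV y = q.onV y' := by
    apply hinj
    change Z.tgt _ = Z.tgt _
    rw [← hqe, ← hqe, q.tgt_onD, q.tgt_onD]
    exact congrArg q.onV h
  -- Both reversed edges issue from the common target and have the same image.
  have hinv : Y.inv (e y) = Y.inv (e y') := by
    refine (hq.2 (Y.tgt (e y))).injOn rfl h.symm ?_
    rw [← q.inv_onD, ← q.inv_onD, hqe, hqe, hv]
  have hee : e y = e y' := by rw [← Y.inv_inv (e y), hinv, Y.inv_inv]
  rw [← he y, ← he y']
  exact congrArg Y.src hee

/-! ### The non-regular quotient -/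

/-- The involution of the edges of `twinGraph`. -/
def twinInv : (Bool × Bool) × Fin 5 → (Bool × Bool) × Fin 5
  | ((false, ε), 0) => ((false, ε), 1)
  | ((false, ε), 1) => ((false, ε), 0)
  | ((true, ε), 0) => ((true, !ε), 0)
  | ((true, ε), 1) => ((true, !ε), 1)
  | ((k, ε), j) => ((!k, ε), j)

/-- The graph with inner vertices `(false, ε)` and outer vertices `(true, ε)`, with a loop at each
inner vertex, three edges from `(false, ε)` to `(true, ε)`, and two edges joining the outer
vertices. -/
abbrev twinGraph : SerreGraph where
  V := Bool × Bool
  D := (Bool × Bool) × Fin 5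
  src := Prod.fst
  inv := twinInv
  inv_inv := by decide
  inv_ne := by decide

/-- A closed walk of length three in `twinGraph` meets at most one outer vertex. -/
theorem twinGraph_triangle (d₁ d₂ d₃ : twinGraph.D) (h₁ : twinGraph.tgt d₁ = twinGraph.src d₂)
    (h₂ : twinGraph.tgt d₂ = twinGraph.src d₃) (h₃ : twinGraph.tgt d₃ = twinGraph.src d₁) :
    (d₁.1.1).toNat + (d₂.1.1).toNat + (d₃.1.1).toNat ≤ 1 := by
  -- An edge changes `ε` exactly when both ends are outer. Two outer vertices on the walk are joined
  -- by such an edge; returning to the same `ε` needs a second one, which makes all three vertices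
  -- outer and gives three changes, an odd number.
  have key : ∀ d : (Bool × Bool) × Fin 5, if d.1.1 && (twinInv d).1.1 then
      (twinInv d).1.2 = !d.1.2 else (twinInv d).1.2 = d.1.2 := by decide
  have k₁ := key d₁
  have k₂ := key d₂
  have k₃ := key d₃
  change (twinInv d₁).1 = d₂.1 at h₁
  change (twinInv d₂).1 = d₃.1 at h₂
  change (twinInv d₃).1 = d₁.1 at h₃
  rw [h₁] at k₁
  rw [h₂] at k₂
  rw [h₃] at k₃
  generalize d₁.1 = a at *
  generalize d₂.1 = b at *
  generalize d₃.1 = c at *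
  revert k₁ k₂ k₃
  clear h₁ h₂ h₃ key d₁ d₂ d₃
  revert a b c
  decide

/-! ### The group -/

/-- The orders of the free factors. -/
def factorOrder : Fin 4 → ℕ := ![3, 2, 2, 2]

/-- The free product of a cyclic group of order three and three cyclic groups of order two. -/
abbrev TriGroup : Type := CoprodI fun i => Multiplicative (ZMod (factorOrder i))

/-- The generator of a free factor. -/
def TriGroup.gen (i : Fin 4) : TriGroup := CoprodI.of (Multiplicative.ofAdd (1 : ZMod (factorOrder i)))

theorem TriGroup.gen_pow (i : Fin 4) : TriGroup.gen i ^ factorOrder i = 1 := by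
  rw [TriGroup.gen, ← map_pow, ← ofAdd_nsmul]
  simp

theorem TriGroup.exists_hom {H : Type} [Group H] (h : Fin 4 → H) (hh : ∀ i, h i ^ factorOrder i = 1) :
    ∃ φ : TriGroup →* H, ∀ i, φ (TriGroup.gen i) = h i := by
  have key : ∀ i, ∃ f : Multiplicative (ZMod (factorOrder i)) →* H,
      f (Multiplicative.ofAdd (1 : ZMod (factorOrder i))) = h i := by
    intro i
    let f : ZMod (factorOrder i) →+ Additive H := ZMod.lift (factorOrder i)
      ⟨zmultiplesHom (Additive H) (Additive.ofMul (h i)), by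
        rw [zmultiplesHom_apply, natCast_zsmul, ← ofMul_pow, hh, ofMul_one]⟩
    refine ⟨AddMonoidHom.toMultiplicativeLeft f, ?_⟩
    change (f 1).toMul = h i
    have h1 : f 1 = Additive.ofMul (h i) := by
      have := ZMod.lift_coe (factorOrder i) ⟨zmultiplesHom (Additive H) (Additive.ofMul (h i)), by
        rw [zmultiplesHom_apply, natCast_zsmul, ← ofMul_pow, hh, ofMul_one]⟩ 1
      simpa using this
    rw [h1]
    rfl
  choose f hf using key
  refine ⟨CoprodI.lift f, fun i => ?_⟩
  rw [TriGroup.gen, CoprodI.lift_of, hf]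

/-- The generators and the inverse of the generator of order three, as values on the five labels of
edges. -/
def withInverse {H : Type} [Group H] (h : Fin 4 → H) : Fin 5 → H :=
  ![h 0, (h 0)⁻¹, h 1, h 2, h 3]

/-- Inversion of labels. -/
def labelInv : Fin 5 → Fin 5 := ![1, 0, 2, 3, 4]

theorem labelInv_labelInv : ∀ l, labelInv (labelInv l) = l := by decide

theorem withInverse_labelInv {H : Type} [Group H] (h : Fin 4 → H)
    (hh : ∀ i, h i ^ factorOrder i = 1) (l : Fin 5) :
    withInverse h (labelInv l) = (withInverse h l)⁻¹ := by
  have h2 : ∀ i, factorOrder i = 2 → h i = (h i)⁻¹ := by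
    intro i hi
    have := hh i
    rw [hi, pow_two] at this
    exact eq_inv_of_mul_eq_one_left this
  fin_cases l
  · rfl
  · exact (_root_.inv_inv (h 0)).symm
  · exact h2 1 rfl
  · exact h2 2 rfl
  · exact h2 3 rfl

theorem map_withInverse {G H : Type} [Group G] [Group H] (φ : G →* H) (h : Fin 4 → G) (l : Fin 5) :
    φ (withInverse h l) = withInverse (fun i => φ (h i)) l := by
  fin_cases l
  · rfl
  · exact map_inv φ (h 0)
  · rfl
  · rfl
  · rfl

/-! ### The regular quotient -/

/-- The images of the generators in the cyclic group of order six. -/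
def prismGen : Fin 4 → Multiplicative (ZMod 6) :=
  ![Multiplicative.ofAdd 2, Multiplicative.ofAdd 3, Multiplicative.ofAdd 3, Multiplicative.ofAdd 3]

theorem prismGen_pow (i : Fin 4) : prismGen i ^ factorOrder i = 1 := by
  fin_cases i <;> decide

theorem prismGen_ne_one (l : Fin 5) : withInverse prismGen l ≠ 1 := by
  revert l; decide

/-- The triangular prism with tripled vertical edges, as a Cayley graph. -/
abbrev prism : SerreGraph :=
  cayley (withInverse prismGen) labelInv labelInv_labelInv
    (withInverse_labelInv prismGen prismGen_pow) prismGen_ne_one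

/-- The vertical generator 3 is odd and ±2 are even, so a product equal to 1 has zero or two
vertical factors. Two leave ±2 ≠ 0, and ±2 ± 2 ± 2 = 0 mod 6 forces equal signs. -/
theorem prism_triangle : ∀ l₁ l₂ l₃ : Fin 5,
    withInverse prismGen l₃ * (withInverse prismGen l₂ * withInverse prismGen l₁) = 1 →
      (l₁ = 0 ∧ l₂ = 0 ∧ l₃ = 0) ∨ (l₁ = 1 ∧ l₂ = 1 ∧ l₃ = 1) := by
  decide

theorem TriGroup.gen_label_ne_one (l : Fin 5) : withInverse TriGroup.gen l ≠ 1 := by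
  obtain ⟨φ, hφ⟩ := TriGroup.exists_hom prismGen prismGen_pow
  intro h
  apply prismGen_ne_one l
  have := map_withInverse φ TriGroup.gen l
  rw [h, map_one] at this
  rw [this]
  simp only [hφ]

/-- The tree of triangles, as a Cayley graph. -/
abbrev triTree : SerreGraph :=
  cayley (withInverse TriGroup.gen) labelInv labelInv_labelInv
    (withInverse_labelInv TriGroup.gen TriGroup.gen_pow) TriGroup.gen_label_ne_one

theorem triTree_isQuasitree : triTree.IsQuasitree := by
  have (i : Fin 4) : DecidableEq (Multiplicative (ZMod (factorOrder i))) := Classical.decEq _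
  refine cayley_isQuasitree _ _ _ _ _ (fun l => ?_) fun i m hm => ?_
  · fin_cases l
    · exact ⟨0, _, rfl⟩
    · exact ⟨0, (Multiplicative.ofAdd 1)⁻¹, (map_inv _ _).symm⟩
    · exact ⟨1, _, rfl⟩
    · exact ⟨2, _, rfl⟩
    · exact ⟨3, _, rfl⟩
  · have three : ∀ m : Multiplicative (ZMod 3), m ≠ 1 →
        m = Multiplicative.ofAdd 1 ∨ m = (Multiplicative.ofAdd 1)⁻¹ := by decide
    have two : ∀ m : Multiplicative (ZMod 2), m ≠ 1 → m = Multiplicative.ofAdd 1 := by decide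
    fin_cases i
    · rcases three m hm with rfl | rfl
      · exact ⟨0, rfl⟩
      · exact ⟨1, (map_inv _ _).symm⟩
    · obtain rfl := two m hm
      exact ⟨2, rfl⟩
    · obtain rfl := two m hm
      exact ⟨3, rfl⟩
    · obtain rfl := two m hm
      exact ⟨4, rfl⟩

theorem exists_isRegularCovering_prism : ∃ p : Hom triTree prism, p.IsRegularCovering := by
  obtain ⟨φ, hφ⟩ := TriGroup.exists_hom prismGen prismGen_pow
  have hmap : ∀ l, φ (withInverse TriGroup.gen l) = withInverse prismGen l := by
    intro l
    rw [map_withInverse]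
    simp only [hφ]
  have hsurj : Function.Surjective φ := by
    intro n
    -- The base maps to 3 - 2 = 1, a generator of Z/6.
    refine ⟨(TriGroup.gen 1 * (TriGroup.gen 0)⁻¹) ^ n.toAdd.val, ?_⟩
    rw [map_pow, map_mul, map_inv, hφ, hφ]
    revert n
    decide
  exact ⟨_, cayleyMap_isRegularCovering _ _ _ _ _ φ hmap _ _ hsurj⟩

/-! ### The non-regular covering -/

/-- A vertex of a graph that covers `twinGraph` and is a union of triangles joined by edges: its
position in the triangle, followed by the data of the triangle. -/
abbrev TwinState : Type := ZMod 3 × ZMod 3 × Bool × Bool × ℕ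

namespace TwinState

/-- Copies of the supply of triangles, used to match inner with outer vertices. -/
def split : ℕ ≃ Bool × Bool × ℕ := 
  Equiv.boolProdNatEquivNat.symm.trans
    ((Equiv.refl Bool).prodCongr Equiv.boolProdNatEquivNat.symm)

/-- The vertex of `twinGraph` below a state. -/
def vertex (σ : TwinState) : Bool × Bool := (decide (σ.1 = 0), σ.2.2.1)

/-- The edges at the vertex below a state, as a function of the labels. -/
def slot (σ : TwinState) (l : Fin 5) : Fin 5 :=
  -- Within a triangle, the outer vertex reaches positions 1 and 2 along `A r` and `A (r + 1)`. Its
  -- third edge `A (r + 2)` leaves by label 3 or 4 according to `b`; the other of these labels takes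
  -- the edge to the twin.
  let A : ZMod 3 → Fin 5 := ![2, 3, 4]
  let r := σ.2.1
  let b := σ.2.2.2.1
  if σ.1 = 0 then ![A r, A (r + 1), 0, bif b then A (r + 2) else 1, bif b then 1 else A (r + 2)] l
  else if σ.1 = 1 then ![0, A r, 1, A (r + 1), A (r + 2)] l
  else ![A (r + 1), 1, 0, A r, A (r + 2)] l

/-- The next vertex in the triangle. -/
def rotate : Equiv.Perm TwinState := (Equiv.addRight (1 : ZMod 3)).prodCongr (Equiv.refl _)

/-- The neighbour along the first edge leaving the triangle. -/
def flip₁ : TwinState → TwinState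
  -- For `j ≠ 0`, negation exchanges positions 1 and 2 of the same state triangle. Such coincidences
  -- are harmless: only an action on the states is needed, and `triTree` unfolds it.
  | (j, r, ε, b, k) => if j = 0 then (j, r, !ε, b, k) else (-j, r, ε, b, k)

/-- The neighbour along the second edge leaving the triangle. -/
def flip₂ : TwinState → TwinState
  | (j, r, ε, b, k) =>
    if j = 0 then
      bif b then
        -- The new `r` makes the same edge `A (r + 2)` appear as `A r'` at position 2 and as `A (r'
        -- + 1)` at position 1. The datum `split k` chooses the position and the remaining data.
        bif (split k).1 then (2, r + 2, ε, (split k).2) else (1, r + 1, ε, (split k).2)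
      else (j, r, !ε, b, k)
    else if j = 1 then (0, r - 1, ε, true, split.symm (false, b, k))
    else (0, r - 2, ε, true, split.symm (true, b, k))

/-- The neighbour along the third edge leaving the triangle. -/
def flip₃ : TwinState → TwinState
  | (j, r, ε, b, k) =>
    if j = 0 then
      bif b then (j, r, !ε, b, k)
      else bif (split k).1 then (2, r, ε, (split k).2) else (1, r, ε, (split k).2)
    else if j = 1 then (0, r, ε, false, split.symm (false, b, k))
    else (0, r, ε, false, split.symm (true, b, k))

theorem flip₁_involutive : Function.Involutive flip₁ := by
  rintro ⟨j, r, ε, b, k⟩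
  by_cases h : j = 0 <;> simp [flip₁, h]

theorem position_cases (j : ZMod 3) : j = 0 ∨ j = 1 ∨ j = 2 := by
  revert j; decide

theorem two_ne_one : (2 : ZMod 3) ≠ 1 := by decide

theorem two_ne_zero : (2 : ZMod 3) ≠ 0 := by decide

theorem flip₂_involutive : Function.Involutive flip₂ := by
  rintro ⟨j, r, ε, b, k⟩
  rcases position_cases j with rfl | rfl | rfl
  · cases b
    · simp [flip₂]
    · rcases h : split k with ⟨c, b', k'⟩
      have h' : split.symm (c, b', k') = k := by rw [← h, Equiv.symm_apply_apply]
      cases c <;> simp [flip₂, h, h', two_ne_one, two_ne_zero]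
  · simp [flip₂]
  · simp [flip₂, two_ne_one, two_ne_zero]

theorem flip₃_involutive : Function.Involutive flip₃ := by
  rintro ⟨j, r, ε, b, k⟩
  rcases position_cases j with rfl | rfl | rfl
  · cases b
    · rcases h : split k with ⟨c, b', k'⟩
      have h' : split.symm (c, b', k') = k := by rw [← h, Equiv.symm_apply_apply]
      cases c <;> simp [flip₃, h, h', two_ne_one, two_ne_zero]
    · simp [flip₃]
  · simp [flip₃]
  · simp [flip₃, two_ne_one, two_ne_zero]

/-- The permutations by which the generators of the group act on the states. -/
def perm : Fin 4 → Equiv.Perm TwinState :=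
  ![rotate, flip₁_involutive.toPerm, flip₂_involutive.toPerm, flip₃_involutive.toPerm]

theorem perm_pow (i : Fin 4) : perm i ^ factorOrder i = 1 := by
  have h2 : ∀ {f : TwinState → TwinState} (hf : Function.Involutive f), hf.toPerm ^ 2 = 1 :=
    fun hf => Equiv.ext fun σ => hf σ
  fin_cases i
  · refine Equiv.ext fun σ => Prod.ext ?_ rfl
    change σ.1 + 1 + 1 + 1 = σ.1
    generalize σ.1 = j
    revert j
    decide
  · exact h2 flip₁_involutive
  · exact h2 flip₂_involutive
  · exact h2 flip₃_involutive

theorem slot_bijective (σ : TwinState) : Function.Bijective (slot σ) := by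
  obtain ⟨j, r, ε, b, k⟩ := σ
  refine Finite.injective_iff_bijective.1 ?_
  -- `slot` ignores `ε` and `k`; fixing them leaves a finite check. Likewise `edge` ignores `k`,
  -- which is set to 0 in the checks below.
  change Function.Injective (slot (j, r, false, b, 0))
  revert j r b
  decide

/-- The edge of `twinGraph` below the edge with a given label at a state. -/
def edge (σ : TwinState) (l : Fin 5) : (Bool × Bool) × Fin 5 := (vertex σ, slot σ l)

theorem twinInv_edge_rotate (σ : TwinState) :
    twinInv (edge σ 0) = edge (rotate σ) 1 ∧ twinInv (edge σ 1) = edge (rotate.symm σ) 0 := by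
  have key : ∀ (j r : ZMod 3) (ε b : Bool),
      twinInv (edge (j, r, ε, b, 0) 0) = edge (j + 1, r, ε, b, 0) 1 ∧
        twinInv (edge (j, r, ε, b, 0) 1) = edge (j - 1, r, ε, b, 0) 0 := by decide
  obtain ⟨j, r, ε, b, k⟩ := σ
  refine ⟨(key j r ε b).1, (key j r ε b).2.trans ?_⟩
  rw [sub_eq_add_neg]
  rfl

theorem twinInv_edge_flip₁ (σ : TwinState) : twinInv (edge σ 2) = edge (flip₁ σ) 2 := by
  have key : ∀ (j r : ZMod 3) (ε b : Bool), twinInv (edge (j, r, ε, b, 0) 2) =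
      edge (if j = 0 then (j, r, !ε, b, 0) else (-j, r, ε, b, 0)) 2 := by decide
  obtain ⟨j, r, ε, b, k⟩ := σ
  refine (key j r ε b).trans ?_
  rw [flip₁]
  split_ifs <;> rfl

theorem twinInv_edge_flip₂ (σ : TwinState) : twinInv (edge σ 3) = edge (flip₂ σ) 3 := by
  have key₀ : ∀ (r : ZMod 3) (ε b c b' : Bool), twinInv (edge (0, r, ε, b, 0) 3) =
      edge (bif b then bif c then (2, r + 2, ε, b', 0) else (1, r + 1, ε, b', 0)
        else (0, r, !ε, b, 0)) 3 := by decide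
  have key₁ : ∀ (r : ZMod 3) (ε b : Bool),
      twinInv (edge (1, r, ε, b, 0) 3) = edge (0, r - 1, ε, true, 0) 3 := by decide
  have key₂ : ∀ (r : ZMod 3) (ε b : Bool),
      twinInv (edge (2, r, ε, b, 0) 3) = edge (0, r - 2, ε, true, 0) 3 := by decide
  obtain ⟨j, r, ε, b, k⟩ := σ
  rcases position_cases j with rfl | rfl | rfl
  · rcases h : split k with ⟨c, b', k'⟩
    refine (key₀ r ε b c b').trans ?_
    rw [flip₂, if_pos rfl, h]
    cases b <;> cases c <;> rfl
  · rw [flip₂, if_neg one_ne_zero, if_pos rfl]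
    exact key₁ r ε b
  · rw [flip₂, if_neg two_ne_zero, if_neg two_ne_one]
    exact key₂ r ε b

theorem twinInv_edge_flip₃ (σ : TwinState) : twinInv (edge σ 4) = edge (flip₃ σ) 4 := by
  have key₀ : ∀ (r : ZMod 3) (ε b c b' : Bool), twinInv (edge (0, r, ε, b, 0) 4) =
      edge (bif b then (0, r, !ε, b, 0)
        else bif c then (2, r, ε, b', 0) else (1, r, ε, b', 0)) 4 := by decide
  have key₁ : ∀ (r : ZMod 3) (ε b : Bool),
      twinInv (edge (1, r, ε, b, 0) 4) = edge (0, r, ε, false, 0) 4 := by decide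
  have key₂ : ∀ (r : ZMod 3) (ε b : Bool),
      twinInv (edge (2, r, ε, b, 0) 4) = edge (0, r, ε, false, 0) 4 := by decide
  obtain ⟨j, r, ε, b, k⟩ := σ
  rcases position_cases j with rfl | rfl | rfl
  · rcases h : split k with ⟨c, b', k'⟩
    refine (key₀ r ε b c b').trans ?_
    rw [flip₃, if_pos rfl, h]
    cases b <;> cases c <;> rfl
  · rw [flip₃, if_neg one_ne_zero, if_pos rfl]
    exact key₁ r ε b
  · rw [flip₃, if_neg two_ne_zero, if_neg two_ne_one]
    exact key₂ r ε b

/-- This compatibility of the action with edge reversal makes the orbit map of a state, followed by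
`vertex`, a graph morphism. -/
theorem twinInv_edge (σ : TwinState) (l : Fin 5) :
    twinInv (edge σ l) = edge (withInverse perm l σ) (labelInv l) := by
  fin_cases l
  · exact (twinInv_edge_rotate σ).1
  · exact (twinInv_edge_rotate σ).2
  · exact twinInv_edge_flip₁ σ
  · exact twinInv_edge_flip₂ σ
  · exact twinInv_edge_flip₃ σ

end TwinState

theorem exists_isCovering_twinGraph : ∃ p : Hom triTree twinGraph, p.IsCovering := by
  obtain ⟨φ, hφ⟩ := TriGroup.exists_hom TwinState.perm TwinState.perm_pow
  have hmap : ∀ l, φ (withInverse TriGroup.gen l) = withInverse TwinState.perm l := by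
    intro l
    rw [map_withInverse]
    simp only [hφ]
  let state : TriGroup → TwinState := fun g => φ g (0, 0, false, false, 0)
  let p : Hom triTree twinGraph :=
    { onV := fun g => TwinState.vertex (state g)
      onD := fun d => TwinState.edge (state d.1) d.2
      src_onD := fun _ => rfl
      inv_onD := fun d => by
        change twinInv _ = TwinState.edge (φ (_ * _) _) _
        rw [TwinState.twinInv_edge, map_mul, hmap]
        rfl }
  have hstar : ∀ v, Set.BijOn p.onD (triTree.star v) (twinGraph.star (p.onV v)) := by
    intro v
    refine ⟨?_, ?_, ?_⟩
    · rintro ⟨g, l⟩ (rfl : g = v)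
      rfl
    · rintro ⟨g, l⟩ (rfl : g = v) ⟨g', l'⟩ (rfl : g' = g) h
      exact Prod.ext rfl ((TwinState.slot_bijective _).1 (Prod.ext_iff.1 h).2)
    · rintro ⟨w, m⟩ (rfl : w = p.onV v)
      obtain ⟨l, hl⟩ := (TwinState.slot_bijective (state v)).2 m
      exact ⟨(v, l), rfl, Prod.ext rfl hl⟩
  -- Surjectivity on stars makes the image closed under moving along edges; connectedness of
  -- `twinGraph` then gives surjectivity.
  have hstep : ∀ w m, w ∈ Set.range p.onV → (twinInv (w, m)).1 ∈ Set.range p.onV := by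
    rintro _ m ⟨v, rfl⟩
    obtain ⟨e, he, hem⟩ := (hstar v).surjOn (rfl : (p.onV v, m) ∈ twinGraph.star (p.onV v))
    exact ⟨triTree.tgt e, by rw [← p.tgt_onD, hem]; rfl⟩
  have h0 : (true, false) ∈ Set.range p.onV := ⟨(1 : TriGroup), by
    change TwinState.vertex (φ 1 _) = _
    rw [map_one]
    rfl⟩
  have h1 : (true, true) ∈ Set.range p.onV := hstep _ 0 h0
  refine ⟨p, ?_, hstar⟩
  rintro ⟨_ | _, _ | _⟩
  · exact hstep _ 2 h0
  · exact hstep _ 2 h1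
  · exact h0
  · exact h1

/-! ### The obstruction -/

/-- Summing over all vertices counts each value three times, since an injective self-map of a finite
set permutes it. -/
theorem sum_comp_le_of_forall_triangle {V : Type} [Fintype V] (f : V → ℕ) (ρ : V → V)
    (hρ : Function.Injective ρ) (h : ∀ v, f v + f (ρ v) + f (ρ (ρ v)) ≤ 1) :
    3 * ∑ v, f v ≤ Fintype.card V := by
  have hs : ∀ g : V → ℕ, ∑ v, g (ρ v) = ∑ v, g v := fun g =>
    (Finite.injective_iff_bijective.1 hρ).sum_comp g
  have h2 : ∑ v, f (ρ (ρ v)) = ∑ v, f v := (hs fun v => f (ρ v)).trans (hs f)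
  have := Finset.sum_le_sum fun v (_ : v ∈ Finset.univ) => h v
  rw [Finset.sum_add_distrib, Finset.sum_add_distrib, h2, hs f] at this
  simp only [Finset.sum_const, Finset.card_univ, smul_eq_mul, mul_one] at this
  omega

theorem no_common_finite_cover {Y : SerreGraph} (hY : Y.IsFinite) {p : Hom triTree Y}
    (hp : p.IsCovering) {q₁ : Hom Y twinGraph} (hq₁ : q₁.IsCovering) {q₂ : Hom Y prism}
    (hq₂ : q₂.IsCovering) : False := by
  have := hY.1
  have := Fintype.ofFinite Y.V
  let f : Y.V → ℕ := fun y => (q₁.onV y).1.toNat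
  -- `ρ` follows one triangle direction of `prism`; `κ` crosses between inner and outer vertices of
  -- `twinGraph`.
  obtain ⟨ρ, hρ, hρe⟩ := hq₂.exists_injective_step (fun v => (v, (0 : Fin 5))) (fun _ => rfl)
    (mul_right_injective (withInverse prismGen 0))
  obtain ⟨κ, hκ, hκe⟩ := hq₁.exists_injective_step (fun v => (v, (2 : Fin 5))) (fun _ => rfl)
    (by decide)
  have hcomp : ∀ y, 1 ≤ f y + f (κ y) := by
    intro y
    obtain ⟨e, -, he, hqe⟩ := hκe y
    have h : q₁.onV (κ y) = (twinInv (q₁.onV y, 2)).1 := by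
      rw [← he, ← q₁.tgt_onD, hqe]
      rfl
    change 1 ≤ (q₁.onV y).1.toNat + (q₁.onV (κ y)).1.toNat
    rw [h]
    generalize q₁.onV y = w
    revert w
    decide
  have hclosed : ∀ e₁ e₂ e₃ : Y.D, Y.tgt e₁ = Y.src e₂ → Y.tgt e₂ = Y.src e₃ →
      Y.tgt e₃ = Y.src e₁ → f (Y.src e₁) + f (Y.src e₂) + f (Y.src e₃) ≤ 1 := by
    intro e₁ e₂ e₃ h₁ h₂ h₃
    have key := twinGraph_triangle (q₁.onD e₁) (q₁.onD e₂) (q₁.onD e₃)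
      (by rw [q₁.tgt_onD, q₁.src_onD, h₁]) (by rw [q₁.tgt_onD, q₁.src_onD, h₂])
      (by rw [q₁.tgt_onD, q₁.src_onD, h₃])
    change (q₁.onV (Y.src e₁)).1.toNat + (q₁.onV (Y.src e₂)).1.toNat +
      (q₁.onV (Y.src e₃)).1.toNat ≤ 1
    rw [← q₁.src_onD, ← q₁.src_onD, ← q₁.src_onD]
    exact key
  have hstep : ∀ e : Y.D, (q₂.onD e).2 = 0 → Y.tgt e = ρ (Y.src e) := by
    intro e he
    obtain ⟨e', hs, ht, hq⟩ := hρe (Y.src e)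
    have : e = e' := by
      refine (hq₂.2 (Y.src e)).injOn rfl hs ?_
      rw [hq]
      exact Prod.ext (q₂.src_onD e) he
    rw [this, ht, ← this]
  have htri : ∀ y, f y + f (ρ y) + f (ρ (ρ y)) ≤ 1 := by
    intro y
    obtain ⟨g, rfl⟩ := hp.1 y
    let t : TriGroup := TriGroup.gen 0
    have ht3 : t * (t * (t * g)) = g := by
      have : t ^ 3 = 1 := TriGroup.gen_pow 0
      rw [← mul_assoc, ← mul_assoc, ← pow_two, ← pow_succ, this, one_mul]
    let d₁ : triTree.D := ((g, 0) : TriGroup × Fin 5)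
    let d₂ : triTree.D := ((t * g, 0) : TriGroup × Fin 5)
    let d₃ : triTree.D := ((t * (t * g), 0) : TriGroup × Fin 5)
    have h₁ : Y.tgt (p.onD d₁) = Y.src (p.onD d₂) := by rw [p.tgt_onD, p.src_onD]; rfl
    have h₂ : Y.tgt (p.onD d₂) = Y.src (p.onD d₃) := by rw [p.tgt_onD, p.src_onD]; rfl
    have h₃ : Y.tgt (p.onD d₃) = Y.src (p.onD d₁) := by
      rw [p.tgt_onD, p.src_onD]
      exact congrArg p.onV ht3
    have h₀ : p.onV g = Y.src (p.onD d₁) := (p.src_onD d₁).symm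
    rw [h₀]
    generalize p.onD d₁ = e₁ at *
    generalize p.onD d₂ = e₂ at *
    generalize p.onD d₃ = e₃ at *
    have hsum := hclosed e₁ e₂ e₃ h₁ h₂ h₃
    have hlab : ∀ e e' : Y.D, Y.tgt e = Y.src e' →
        withInverse prismGen (q₂.onD e).2 * q₂.onV (Y.src e) = q₂.onV (Y.src e') := by
      intro e e' h
      rw [← h, ← q₂.tgt_onD, ← q₂.src_onD]
      rfl
    -- The image in `prism` of a triangle of `triTree` closes up, so its labels are all 0 or all 1:
    -- it runs along `ρ` or against it.
    have hprod := hlab e₃ e₁ h₃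
    rw [← hlab e₂ e₃ h₂, ← hlab e₁ e₂ h₁, ← mul_assoc, ← mul_assoc, mul_eq_right, mul_assoc]
      at hprod
    rcases prism_triangle _ _ _ hprod with ⟨l₁, l₂, l₃⟩ | ⟨l₁, l₂, l₃⟩
    · rw [← hstep e₁ l₁, h₁, ← hstep e₂ l₂, h₂]
      exact hsum
    · have hinv : ∀ e : Y.D, (q₂.onD e).2 = 1 → ρ (Y.tgt e) = Y.src e := by
        intro e he
        have h : (q₂.onD (Y.inv e)).2 = 0 := by
          rw [← q₂.inv_onD]
          change labelInv (q₂.onD e).2 = 0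
          rw [he]
          rfl
        have := hstep (Y.inv e) h
        rw [tgt, Y.inv_inv] at this
        exact this.symm
      have r₁ := hinv e₃ l₃
      have r₂ := hinv e₂ l₂
      rw [h₃] at r₁
      rw [h₂] at r₂
      rw [r₁, r₂]
      omega
  -- With S the number of outer vertices and n the number of all vertices, 3S ≤ n ≤ 2S forces n = 0.
  have hN := sum_comp_le_of_forall_triangle f ρ hρ htri
  have hP : Fintype.card Y.V ≤ 2 * ∑ y, f y := by
    have hs : ∑ y, f (κ y) = ∑ y, f y := (Finite.injective_iff_bijective.1 hκ).sum_comp f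
    have := Finset.sum_le_sum fun v (_ : v ∈ Finset.univ) => hcomp v
    rw [Finset.sum_add_distrib, hs] at this
    simp only [Finset.sum_const, Finset.card_univ, smul_eq_mul, mul_one] at this
    omega
  have hpos : 0 < Fintype.card Y.V := Fintype.card_pos_iff.2 ⟨p.onV (1 : TriGroup)⟩
  omega

end SerreGraph

theorem theorem1p3 :
    ∃ X X₁ X₂ : SerreGraph,
      X.IsLocallyFinite ∧ X.IsQuasitree ∧ X₁.IsFinite ∧ X₂.IsFinite ∧
      (∃ p₁ : SerreGraph.Hom X X₁, p₁.IsCovering) ∧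
      (∃ p₂ : SerreGraph.Hom X X₂, p₂.IsRegularCovering) ∧
      (∃ Γ : Subgroup X.Aut, X.IsUniformLattice Γ) ∧
      ¬ ∃ Y : SerreGraph, Y.IsFinite ∧ X.Covers Y ∧ Y.Covers X₁ ∧ Y.Covers X₂ := by
  open SerreGraph in
  refine ⟨triTree, twinGraph, prism, cayley_isLocallyFinite _ _ _ _ _, triTree_isQuasitree,
    ⟨inferInstanceAs (Finite (Bool × Bool)), inferInstanceAs (Finite ((Bool × Bool) × Fin 5))⟩,
    ⟨inferInstanceAs (Finite (ZMod 6)), inferInstanceAs (Finite (ZMod 6 × Fin 5))⟩,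
    exists_isCovering_twinGraph, exists_isRegularCovering_prism,
    ⟨_, cayleyLattice_isUniformLattice _ _ _ _ _⟩, ?_⟩
  rintro ⟨Y, hY, ⟨p, hp⟩, ⟨q₁, hq₁⟩, ⟨q₂, hq₂⟩⟩
  exact SerreGraph.no_common_finite_cover hY hp hq₁ hq₂
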